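/- All graphs are finite and simple. Let $G$ be a graph of order $n$ with $e(G)$ edges and minimum degree at least $\delta$, where $\delta\ge 0$ is an integer. For $k\ge 1$, a $k$-factor of $G$ is a $k$-regular spanning subgraph. For a positive integer $l$, the $l$-closure $C_l(G)$ is the graph obtained from $G$ by successively joining pairs of distinct nonadjacent vertices whose degree sum (in the current graph) is at least $l$, until no such pair exists. Write $G_1+G_2$ for the disjoint union and $G_1\vee G_2$ for the join of two vertex-disjoint graphs, $K_m$ for the complete graph on $m$ vertices and $I_m$ for the graph with $m$ vertices and no edges. For integers $n,r,k,q$ put $$\varphi(n,r,q)=\binom{n-q-1}{r}+(q+1)\binom{q}{r-1},\qquad \phi(n,r,k,q)=\binom{n-q+2k-4}{r}+(q-2k+4)\binom{q}{r-1}.$$ (i) Suppose that $n$ is even, $n\ge 6\delta+10$, $1\le\delta\le \frac n2-1$ and $e(G)>\varphi(n,2,\delta+1)$. Then $G$ has a $1$-factor unless either $\delta$ is even and $C_{n-1}(G)\cong K_{n-\delta-1}+K_{\delta+1}$, or $C_{n-1}(G)\cong K_\delta\vee(K_{n-2\delta-1}+I_{\delta+1})$; in these two exceptional cases $G$ has no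 $1$-factor. (ii) Let $k\ge 2$ be an integer. Suppose that $nk$ is even, $n\ge 6\delta+4k-3$, $2k-2\le\delta\le\left\lfloor\frac{n+2k-5}{2}\right\rfloor$ and $e(G)>\phi(n,2,k,\delta+1)$. Then $G$ has a $k$-factor. -/

import Mathlib

namespace KFactor

/-- The function `φ(n,r,q) = C(n-q-1, r) + (q+1) C(q, r-1)` of integers `n, q` (and `r ≥ 1`). -/
def phiOne (n : ℤ) (r : ℕ) (q : ℤ) : ℤ :=
  Ring.choose (n - q - 1) r + (q + 1) * Ring.choose q (r - 1)

/-- The function `ϕ(n,r,k,q) = C(n-q+2k-4, r) + (q-2k+4) C(q, r-1)` of integers `n, k, q`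
(and `r ≥ 1`). -/
def phiTwo (n : ℤ) (r : ℕ) (k q : ℤ) : ℤ :=
  Ring.choose (n - q + 2 * k - 4) r + (q - 2 * k + 4) * Ring.choose q (r - 1)

open scoped Classical in
/-- `G` has a `k`-factor: a `k`-regular spanning subgraph. -/
def HasFactor {V : Type*} [Fintype V] (G : SimpleGraph V) (k : ℕ) : Prop :=
  ∃ F : SimpleGraph V, F ≤ G ∧ F.IsRegularOfDegree k

/-- The join `G ∨ H`: the disjoint union together with all edges between the two parts. -/
def join {V W : Type*} (G : SimpleGraph V) (H : SimpleGraph W) : SimpleGraph (V ⊕ W) :=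
  (G ⊕g H) ⊔ completeBipartiteGraph V W

section Closure

variable {V : Type*} [Fintype V]

open scoped Classical in
/-- `u` and `v` are distinct nonadjacent vertices of `G` with degree sum at least `l`. -/
def Joinable (l : ℕ) (G : SimpleGraph V) (u v : V) : Prop :=
  u ≠ v ∧ ¬ G.Adj u v ∧ l ≤ G.degree u + G.degree v

/-- `H` arises from `G` by joining one pair of nonadjacent vertices with degree sum at
least `l`. -/
def ClosureStep (l : ℕ) (G H : SimpleGraph V) : Prop :=
  ∃ u v : V, Joinable l G u v ∧ H = G ⊔ SimpleGraph.edge u v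

/-- `H` is obtained from `G` by successively joining nonadjacent pairs with degree sum at
least `l` until no such pair exists. -/
def IsClosure (l : ℕ) (G H : SimpleGraph V) : Prop :=
  Relation.ReflTransGen (ClosureStep l) G H ∧ ∀ u v : V, ¬ Joinable l H u v

theorem exists_isClosure (l : ℕ) (G : SimpleGraph V) : ∃ H, IsClosure l G H := by
  induction G using WellFoundedGT.induction with
  | ind G ih =>
    by_cases h : ∀ u v : V, ¬ Joinable l G u v
    · exact ⟨G, .refl, h⟩
    · push Not at h
      obtain ⟨u, v, huv⟩ := h
      obtain ⟨H, hH, hc⟩ := ih _ (SimpleGraph.lt_sup_edge G u v huv.1 huv.2.1)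
      exact ⟨H, .head ⟨u, v, huv, rfl⟩ hH, hc⟩

theorem IsClosure.le_of_closed {l : ℕ} {G H K : SimpleGraph V}
    (hH : Relation.ReflTransGen (ClosureStep l) G H) (hGK : G ≤ K)
    (hK : ∀ u v : V, ¬ Joinable l K u v) : H ≤ K := by
  classical
  induction hH with
  | refl => exact hGK
  | tail _ hs ih =>
    obtain ⟨u, v, ⟨hne, -, hd⟩, rfl⟩ := hs
    refine sup_le ih ((SimpleGraph.edge_le_iff _).2 (Or.inr ?_))
    by_contra hn
    exact hK u v ⟨hne, hn, hd.trans
      (add_le_add (SimpleGraph.degree_le_of_le ih) (SimpleGraph.degree_le_of_le ih))⟩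

theorem IsClosure.le {l : ℕ} {G H : SimpleGraph V} (h : IsClosure l G H) : G ≤ H := by
  obtain ⟨h, -⟩ := h
  induction h with
  | refl => exact le_rfl
  | tail _ hs ih =>
    obtain ⟨u, v, -, rfl⟩ := hs
    exact ih.trans le_sup_left

/-- The result of the closure process does not depend on the choices made. -/
theorem IsClosure.unique {l : ℕ} {G H K : SimpleGraph V} (hH : IsClosure l G H)
    (hK : IsClosure l G K) : H = K :=
  le_antisymm (IsClosure.le_of_closed hH.1 hK.le hK.2) (IsClosure.le_of_closed hK.1 hH.le hH.2)

/-- The `l`-closure `C_l(G)`. -/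
noncomputable def closure (l : ℕ) (G : SimpleGraph V) : SimpleGraph V :=
  Classical.choose (exists_isClosure l G)

theorem closure_isClosure (l : ℕ) (G : SimpleGraph V) : IsClosure l G (closure l G) :=
  Classical.choose_spec (exists_isClosure l G)

end Closure

end KFactor

/-!
Let `F` be a `k`-regular spanning subgraph of `G + uv` that uses the new edge `uv`. Without that
edge, `F` lies in `G` and has a deficit of one edge at `u` and at `v`, and replacing an edge `ax` of
`F` by an edge `ua` of `G \ F` carries the deficit from `u` to `x`. If `G` has no `k`-factor, it
follows that no edge of `F` joins a `G \ F`-neighbour of `u` to one of `v`, and double counting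
bounds the sizes of these two neighbourhoods. So joining `u` and `v` when their degree sum is large
creates no new `k`-factor, and `G` may be replaced by its closure `H`.

By the edge bound, `H` is complete or consists of a clique and a set `L` of vertices of degree `δ`.
In the second case joining one more vertex to some `u ∈ L` makes the closure complete, hence with
a `k`-factor; so if `H` has none, it has a spanning subgraph `F` with deficits at `u` and at
a vertex of the clique. The two deficits can never both lie in the clique, so every `F`-neighbour
of an `H \ F`-neighbour of `u` is in `L`. Counting these edges of `F` excludes `k ≥ 3`. For `k = 2`
a second rotation gives a contradiction, and for `k = 1` it shows that `L` is independent with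
a common neighbourhood unless `L` is a component.
-/

namespace KFactor

section

open Finset SimpleGraph
open scoped Classical

variable {V : Type*} {F G H : SimpleGraph V} {k : ℕ} {u v : V}

/-- The subgraph `F` with the edge `ax` replaced by `ua`: the move along an alternating path
that carries a deficit from `u` to `x`. -/
def rotate (F : SimpleGraph V) (u a x : V) : SimpleGraph V :=
  (F ⊔ edge u a) \ edge a x

theorem rotate_adj {a x p q : V} : (rotate F u a x).Adj p q ↔
    (F.Adj p q ∨ s(u, a) = s(p, q) ∧ p ≠ q) ∧ ¬ (s(a, x) = s(p, q) ∧ p ≠ q) := by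
  simp only [rotate, sdiff_adj, sup_adj, edge_adj]; grind

theorem degree_sup_edge {a b : V} (hab : a ≠ b) (h : ¬ F.Adj a b) (z : V)
    [Fintype (F.neighborSet z)] [Fintype ((F ⊔ edge a b).neighborSet z)] :
    (F ⊔ edge a b).degree z =
      F.degree z + (if z = a then 1 else 0) + (if z = b then 1 else 0) := by
  rw [← card_neighborFinset_eq_degree, ← card_neighborFinset_eq_degree]
  rcases eq_or_ne z a with rfl | hza
  · have : (F ⊔ edge z b).neighborFinset z = insert b (F.neighborFinset z) := by
      ext; simp [edge_adj]; grind
    simp [this, h, hab]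
  rcases eq_or_ne z b with rfl | hzb
  · have : (F ⊔ edge a z).neighborFinset z = insert a (F.neighborFinset z) := by
      ext; simp [edge_adj]; grind
    simp [this, F.adj_comm z, h, hza]
  · have : (F ⊔ edge a b).neighborFinset z = F.neighborFinset z := by
      ext; simp [edge_adj]; grind
    simp [this, hza, hzb]

theorem degree_sdiff_edge {a b : V} (h : F.Adj a b) (z : V)
    [Fintype (F.neighborSet z)] [Fintype ((F \ edge a b).neighborSet z)] :
    (F \ edge a b).degree z + (if z = a then 1 else 0) + (if z = b then 1 else 0) =
      F.degree z := by
  have hF : F \ edge a b ⊔ edge a b = F := sdiff_sup_cancel ((edge_le_iff _).2 (.inr h))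
  have : Fintype ((F \ edge a b ⊔ edge a b).neighborSet z) := by rwa [hF]
  rw [← degree_sup_edge h.ne (by simp [edge_adj, h.ne])]
  congr!

variable [Fintype V]

section DoubleCounting

variable {P Q : Finset V}

theorem sum_degree_eq_sum_card_inter (hPQ : ∀ x ∈ P, F.neighborFinset x ⊆ Q) :
    ∑ x ∈ P, F.degree x = ∑ y ∈ Q, #(P ∩ F.neighborFinset y) := by
  calc ∑ x ∈ P, F.degree x
      = ∑ x ∈ P, #(Q.bipartiteAbove F.Adj x) := by
        refine sum_congr rfl fun x hx => ?_
        rw [← card_neighborFinset_eq_degree]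
        congr 1
        ext y
        simpa [bipartiteAbove] using fun h => hPQ x hx ((F.mem_neighborFinset x y).2 h)
    _ = ∑ y ∈ Q, #(P.bipartiteBelow F.Adj y) := sum_card_bipartiteAbove_eq_sum_card_bipartiteBelow _
    _ = ∑ y ∈ Q, #(P ∩ F.neighborFinset y) := by
        simp only [bipartiteBelow, ← filter_mem_eq_inter, mem_neighborFinset, F.adj_comm]

theorem card_le_card_of_neighborFinset_subset (hk : 0 < k) (hP : ∀ x ∈ P, k ≤ F.degree x)
    (hQ : ∀ y ∈ Q, F.degree y ≤ k) (hPQ : ∀ x ∈ P, F.neighborFinset x ⊆ Q) : #P ≤ #Q := by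
  refine Nat.le_of_mul_le_mul_right ?_ hk
  calc #P * k ≤ ∑ x ∈ P, F.degree x := card_nsmul_le_sum _ _ _ hP
    _ = ∑ y ∈ Q, #(P ∩ F.neighborFinset y) := sum_degree_eq_sum_card_inter hPQ
    _ ≤ #Q * k := sum_le_card_nsmul _ _ _ fun y hy =>
        (card_le_card inter_subset_right).trans (hQ y hy)

theorem saturated_of_neighborFinset_subset (hP : ∀ x ∈ P, k ≤ F.degree x)
    (hQ : ∀ y ∈ Q, F.degree y ≤ k) (hPQ : ∀ x ∈ P, F.neighborFinset x ⊆ Q) (hcard : #Q ≤ #P)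
    {y : V} (hy : y ∈ Q) : F.degree y = k ∧ F.neighborFinset y ⊆ P := by
  have hle : ∀ z ∈ Q, #(P ∩ F.neighborFinset z) ≤ k := fun z hz =>
    (card_le_card inter_subset_right).trans (hQ z hz)
  have hsum : ∑ z ∈ Q, #(P ∩ F.neighborFinset z) = ∑ _z ∈ Q, k := by
    refine (sum_le_sum hle).antisymm ?_
    calc ∑ _z ∈ Q, k ≤ #P * k := by rw [sum_const, smul_eq_mul]; gcongr
      _ ≤ ∑ x ∈ P, F.degree x := card_nsmul_le_sum _ _ _ hP
      _ = _ := sum_degree_eq_sum_card_inter hPQ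
  have hyk : #(P ∩ F.neighborFinset y) = k := (sum_eq_sum_iff_of_le hle).1 hsum y hy
  have hNP : P ∩ F.neighborFinset y = F.neighborFinset y :=
    eq_of_subset_of_card_le inter_subset_right (by simpa [hyk] using hQ y hy)
  rw [hNP] at hyk
  exact ⟨by simpa using hyk, inter_eq_right.1 hNP⟩

end DoubleCounting

theorem hasFactor_iff : HasFactor G k ↔ ∃ F ≤ G, ∀ z, F.degree z = k := by
  rfl

theorem HasFactor.mono (h : HasFactor G k) (hGH : G ≤ H) : HasFactor H k :=
  h.imp fun _ hF => ⟨hF.1.trans hGH, hF.2⟩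

/-- `F` is a spanning subgraph of `G` in which `u` and `v` each lack one edge for `F` to be
`k`-regular; for `u = v` this vertex lacks two edges. -/
structure IsNearFactor (G F : SimpleGraph V) (k : ℕ) (u v : V) : Prop where
  le : F ≤ G
  degree_add : ∀ z, F.degree z + (if z = u then 1 else 0) + (if z = v then 1 else 0) = k

/-- The vertices that can be joined to `u` when the subgraph `F` of `G` is to be extended
inside `G`. -/
noncomputable def free (G F : SimpleGraph V) (u : V) : Finset V :=
  G.neighborFinset u \ F.neighborFinset u

theorem mem_free {a : V} : a ∈ free G F u ↔ G.Adj u a ∧ ¬ F.Adj u a := by simp [free]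

theorem card_free_add_degree (hF : F ≤ G) (u : V) :
    #(free G F u) + F.degree u = G.degree u := by
  rw [free, ← card_neighborFinset_eq_degree, ← card_neighborFinset_eq_degree]
  exact card_sdiff_add_card_eq_card fun z hz => by simpa using hF (by simpa using hz)

theorem degree_rotate {a x : V} (hua : u ≠ a) (hnadj : ¬ F.Adj u a) (hax : F.Adj a x) (z : V) :
    (rotate F u a x).degree z + (if z = x then 1 else 0) =
      F.degree z + (if z = u then 1 else 0) := by
  have hdel := degree_sdiff_edge (F := F ⊔ edge u a) (.inl hax) z
  have hadd := degree_sup_edge hua hnadj z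
  have heq : (rotate F u a x).degree z = ((F ⊔ edge u a) \ edge a x).degree z := by
    unfold rotate
    congr!
  omega

namespace IsNearFactor

theorem symm (h : IsNearFactor G F k u v) : IsNearFactor G F k v u :=
  ⟨h.le, fun z => by have := h.degree_add z; omega⟩

theorem degree_le (h : IsNearFactor G F k u v) (z : V) : F.degree z ≤ k := by
  have := h.degree_add z; omega

theorem degree_eq (h : IsNearFactor G F k u v) {z : V} (hu : z ≠ u) (hv : z ≠ v) :
    F.degree z = k := by
  simpa [hu, hv] using h.degree_add z

theorem degree_left (h : IsNearFactor G F k u v) (huv : u ≠ v) : F.degree u + 1 = k := by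
  simpa [huv] using h.degree_add u

theorem rotate {a x : V} (h : IsNearFactor G F k u v) (ha : a ∈ free G F u) (hax : F.Adj a x) :
    IsNearFactor G (rotate F u a x) k x v := by
  rw [mem_free] at ha
  refine ⟨(sdiff_le.trans (sup_le h.le ((edge_le_iff _).2 (.inr ha.1)))), fun z => ?_⟩
  rw [degree_rotate ha.1.ne ha.2 hax]
  exact h.degree_add z

theorem hasFactor (h : IsNearFactor G F k u v) (hv : v ∈ free G F u) : HasFactor G k := by
  rw [mem_free] at hv
  refine hasFactor_iff.2 ⟨F ⊔ edge u v, sup_le h.le ((edge_le_iff _).2 (.inr hv.1)), fun z => ?_⟩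
  rw [← h.degree_add z]
  convert degree_sup_edge hv.1.ne hv.2 z

theorem notMem_free (h : IsNearFactor G F k u v) (hG : ¬ HasFactor G k) : v ∉ free G F u :=
  fun hv => hG (h.hasFactor hv)

theorem degree_of_mem_free (h : IsNearFactor G F k u v) (hG : ¬ HasFactor G k) {a : V}
    (ha : a ∈ free G F u) : F.degree a = k :=
  h.degree_eq (mem_free.1 ha).1.ne' fun hav => h.notMem_free hG (hav ▸ ha)

theorem not_adj_free_free (h : IsNearFactor G F k u v) (hG : ¬ HasFactor G k) {a b : V}
    (ha : a ∈ free G F u) (hb : b ∈ free G F v) : ¬ F.Adj a b := by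
  intro hab
  have := h.notMem_free hG
  refine (h.rotate ha hab).notMem_free hG (mem_free.2 ?_)
  exact ⟨(mem_free.1 hb).1.symm, by grind [rotate_adj, mem_free, SimpleGraph.adj_comm, hab.ne]⟩

theorem card_free_add_card_free_le (h : IsNearFactor G F k u v) (hG : ¬ HasFactor G k)
    (huv : u ≠ v) : #(free G F u) + #(free G F v) + 2 ≤ Fintype.card V := by
  have hu : u ∉ free G F v := h.symm.notMem_free hG
  have hlt : #(free G F u) < #(insert u (free G F v))ᶜ := by
    by_contra! hcard
    have hsub : ∀ a ∈ free G F u, F.neighborFinset a ⊆ (insert u (free G F v))ᶜ := by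
      intro a ha b hab
      have := h.not_adj_free_free hG ha (b := b)
      grind [mem_compl, mem_free, mem_neighborFinset, SimpleGraph.adj_comm]
    have hsat := saturated_of_neighborFinset_subset
      (fun a ha => (h.degree_of_mem_free hG ha).ge) (fun y _ => h.degree_le y) hsub hcard
      (y := v) (by simp [huv.symm, mem_free])
    have := h.symm.degree_left huv.symm
    omega
  rw [card_compl, card_insert_of_notMem hu] at hlt
  omega

theorem exists_mem_free_adj (h : IsNearFactor G F k u v) (hk : 2 ≤ k) (hG : ¬ HasFactor G k)
    (huv : u ≠ v) (hadj : ¬ G.Adj u v)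
    (hcard : Fintype.card V ≤ #(free G F u) + #(free G F v) + 2) :
    ∃ b ∈ free G F v, F.Adj u b := by
  by_contra! hno
  have hdeg := h.degree_left huv
  obtain ⟨w, hw⟩ : ∃ w, F.Adj u w := by
    rw [← degree_pos_iff_exists_adj]; omega
  have hQ : #(insert u (insert v (free G F u)))ᶜ ≤ #(free G F v) := by
    rw [card_compl, card_insert_of_notMem (by simp [mem_free, huv]),
      card_insert_of_notMem (by simp [mem_free, hadj])]
    omega
  have hsub : ∀ b ∈ free G F v, F.neighborFinset b ⊆ (insert u (insert v (free G F u)))ᶜ := by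
    intro b hb a hab
    have := h.not_adj_free_free hG (a := a) (b := b)
    grind [mem_compl, mem_free, mem_neighborFinset, SimpleGraph.adj_comm]
  have hsat := saturated_of_neighborFinset_subset
    (fun b hb => (h.symm.degree_of_mem_free hG hb).ge) (fun y _ => h.degree_le y) hsub hQ
    (y := w) (by grind [mem_compl, mem_free, h.le hw, hw.ne])
  have huB : u ∈ free G F v := hsat.2 (by simpa using hw.symm)
  exact hadj (mem_free.1 huB).1.symm

theorem not_adj_of_mem_free (h : IsNearFactor G F k u v) (hG : ¬ HasFactor G k) {b : V}
    (hadj : ¬ G.Adj u v) (hb : b ∈ free G F v) (hub : F.Adj u b) {a a' : V} (ha : a ∈ free G F u)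
    (ha' : a' ∈ free G F u) : ¬ F.Adj a a' := by
  intro haa'
  have h₁ := h.rotate ha haa'
  have hu : u ∈ free G (KFactor.rotate F u a a') a' := by
    grind [rotate_adj, mem_free, SimpleGraph.adj_comm, haa'.ne]
  have h₂ := h₁.rotate hu (x := b) (by grind [rotate_adj, mem_free, SimpleGraph.adj_comm])
  refine h₂.notMem_free hG (mem_free.2 ?_)
  grind [rotate_adj, mem_free, SimpleGraph.adj_comm]

theorem free_subset_free (h : IsNearFactor G F k u v) (hk : 2 ≤ k) (hG : ¬ HasFactor G k)
    (huv : u ≠ v) (hadj : ¬ G.Adj u v)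
    (hcard : Fintype.card V ≤ #(free G F u) + #(free G F v) + 2) :
    free G F u ⊆ free G F v := by
  obtain ⟨b, hb, hub⟩ := h.exists_mem_free_adj hk hG huv hadj hcard
  have hlt : #(free G F u) < #(insert u (free G F u ∪ free G F v))ᶜ := by
    by_contra! hle
    have hsub : ∀ a ∈ free G F u, F.neighborFinset a ⊆ (insert u (free G F u ∪ free G F v))ᶜ := by
      intro a ha x hax
      have := h.not_adj_free_free hG ha (b := x)
      have := h.not_adj_of_mem_free hG hadj hb hub ha (a' := x)
      grind [mem_compl, mem_free, mem_neighborFinset, SimpleGraph.adj_comm]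
    have hsat := saturated_of_neighborFinset_subset
      (fun a ha => (h.degree_of_mem_free hG ha).ge) (fun y _ => h.degree_le y) hsub hle
      (y := v) (by simp [huv.symm, mem_free, hadj])
    have := h.symm.degree_left huv.symm
    omega
  have hu : u ∉ free G F u ∪ free G F v := by
    simp [mem_free, mt SimpleGraph.Adj.symm hadj]
  rw [card_compl, card_insert_of_notMem hu] at hlt
  rw [← union_eq_right]
  exact (eq_of_subset_of_card_le subset_union_right (by omega)).symm

theorem card_free_add_card_free_lt (h : IsNearFactor G F k u v) (hk : 2 ≤ k) (hG : ¬ HasFactor G k)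
    (huv : u ≠ v) (hadj : ¬ G.Adj u v) :
    #(free G F u) + #(free G F v) + 2 < Fintype.card V := by
  by_contra! hcard
  obtain ⟨b, hb, hub⟩ := h.exists_mem_free_adj hk hG huv hadj hcard
  have hba := h.symm.free_subset_free hk hG huv.symm (mt .symm hadj) (by omega) hb
  exact (mem_free.1 hba).2 hub

end IsNearFactor

theorem HasFactor.of_sup_edge (h : HasFactor (G ⊔ edge u v) k) :
    HasFactor G k ∨ ∃ F, IsNearFactor G F k u v := by
  obtain ⟨F, hF, hreg⟩ := hasFactor_iff.1 h
  by_cases huv : F.Adj u v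
  · refine .inr ⟨F \ edge u v, sdiff_le_iff'.2 hF, fun z => ?_⟩
    rw [← hreg z]
    convert degree_sdiff_edge huv z
  · refine .inl (hasFactor_iff.2 ⟨F, fun p q hpq => ?_, hreg⟩)
    rcases hF hpq with hG | he
    · exact hG
    · grind [SimpleGraph.adj_comm]

/-- The degree sum from which on a nonadjacent pair can be joined without affecting the existence
of a `k`-factor of a graph of order `n`. -/
def threshold (n k : ℕ) : ℕ := if k = 1 then n - 1 else n + 2 * k - 4

theorem hasFactor_of_sup_edge (hk : 1 ≤ k) (hj : Joinable (threshold (Fintype.card V) k) G u v)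
    (h : HasFactor (G ⊔ edge u v) k) : HasFactor G k := by
  obtain ⟨huv, hadj, hdeg⟩ := hj
  by_contra hG
  obtain ⟨F, hF⟩ := h.of_sup_edge.resolve_left hG
  have hu := card_free_add_degree hF.le u
  have hv := card_free_add_degree hF.le v
  have hdu := hF.degree_left huv
  have hdv := hF.symm.degree_left huv.symm
  have hle := hF.card_free_add_card_free_le hG huv
  rw [threshold] at hdeg
  split_ifs at hdeg with hk1
  · omega
  · have := hF.card_free_add_card_free_lt (lt_of_le_of_ne hk (.symm hk1)) hG huv hadj
    omega

theorem hasFactor_of_closure (hk : 1 ≤ k)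
    (h : HasFactor (closure (threshold (Fintype.card V) k) G) k) : HasFactor G k := by
  obtain ⟨hsteps, -⟩ := closure_isClosure (threshold (Fintype.card V) k) G
  generalize closure (threshold (Fintype.card V) k) G = K at h hsteps
  induction hsteps with
  | refl => exact h
  | tail _ hstep ih =>
    obtain ⟨u, v, huv, rfl⟩ := hstep
    exact ih (hasFactor_of_sup_edge hk huv h)

section Constructions

variable {W : Type*} [Fintype W] {G' : SimpleGraph W}

theorem HasFactor.of_iso (e : G ≃g G') (h : HasFactor G k) : HasFactor G' k := by
  obtain ⟨F, hF, hreg⟩ := hasFactor_iff.1 h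
  refine hasFactor_iff.2 ⟨F.comap e.symm, fun x y hxy => ?_, fun x => ?_⟩
  · exact e.symm.map_rel_iff'.1 (hF hxy)
  · rw [← hreg (e.symm x)]
    exact (Iso.degree_eq (Iso.comap e.symm.toEquiv F) x).symm

theorem HasFactor.even_card_mul (h : HasFactor G k) : Even (Fintype.card V * k) := by
  obtain ⟨F, -, hreg⟩ := hasFactor_iff.1 h
  have := F.sum_degrees_eq_twice_card_edges
  simp only [hreg, sum_const, card_univ, smul_eq_mul] at this
  exact this ▸ even_two_mul _

theorem degree_apply_of_injective {F' : SimpleGraph W} {f : V → W} (hf : f.Injective) {x : V}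
    (h : F'.neighborSet (f x) = f '' F.neighborSet x) : F'.degree (f x) = F.degree x := by
  simp only [← card_neighborSet_eq_degree, ← Nat.card_eq_fintype_card, h]
  exact Nat.card_image_of_injective hf _

theorem hasFactor_sum_iff : HasFactor (G ⊕g G') k ↔ HasFactor G k ∧ HasFactor G' k := by
  constructor
  · intro h
    obtain ⟨F, hF, hreg⟩ := hasFactor_iff.1 h
    refine ⟨hasFactor_iff.2 ⟨F.comap .inl, fun x y hxy => by simpa using hF hxy, fun x => ?_⟩,
      hasFactor_iff.2 ⟨F.comap .inr, fun x y hxy => by simpa using hF hxy, fun x => ?_⟩⟩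
    · rw [← hreg (.inl x), degree_apply_of_injective Sum.inl_injective]
      ext (y | y)
      · simp
      · simpa using fun hxy => not_adj_sum_inl_inr x y (hF hxy)
    · rw [← hreg (.inr x), degree_apply_of_injective Sum.inr_injective]
      ext (y | y)
      · simpa using fun hxy => not_adj_sum_inl_inr y x (hF hxy).symm
      · simp
  · rintro ⟨h, h'⟩
    obtain ⟨F, hF, hreg⟩ := hasFactor_iff.1 h
    obtain ⟨F', hF', hreg'⟩ := hasFactor_iff.1 h'
    refine hasFactor_iff.2 ⟨F ⊕g F', ?_, ?_⟩
    · rintro (x | x) (y | y) hxy <;> simp only [SimpleGraph.sum_adj] at hxy ⊢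
      exacts [hF hxy, hF' hxy]
    · rintro (x | x)
      · rw [← hreg x]
        convert degree_apply_of_injective Sum.inl_injective (neighborSet_sum_inl x)
      · rw [← hreg' x]
        convert degree_apply_of_injective Sum.inr_injective (neighborSet_sum_inr x)

theorem card_le_of_hasFactor_join {U : Type*} [Fintype U] (hk : 0 < k)
    (h : HasFactor (join G (G' ⊕g emptyGraph U)) k) : Fintype.card U ≤ Fintype.card V := by
  obtain ⟨F, hF, hreg⟩ := hasFactor_iff.1 h
  have hle : #((univ : Finset U).map (Function.Embedding.inr.trans (.inr : W ⊕ U ↪ V ⊕ W ⊕ U))) ≤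
      #((univ : Finset V).map (.inl : V ↪ V ⊕ W ⊕ U)) := by
    refine card_le_card_of_neighborFinset_subset (F := F) hk (fun x _ => (hreg x).ge)
      (fun x _ => (hreg x).le) fun x hx y hxy => ?_
    have hxy := hF ((F.mem_neighborFinset x y).1 hxy)
    obtain ⟨z, -, rfl⟩ := mem_map.1 hx
    rcases y with y | y | y <;> simp_all [join]
  simpa using hle

theorem exists_neg_mem_finset_of_even {n : ℕ} (hkn : k < n) (hk : Even k) :
    ∃ S : Finset (ZMod n), 0 ∉ S ∧ (∀ x ∈ S, -x ∈ S) ∧ #S = k := by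
  obtain ⟨m, rfl⟩ := hk
  have hinj : Set.InjOn (fun i : ℤ => (i : ZMod n)) (Icc (-m : ℤ) m) := by
    intro i hi j hj hij
    have hdvd := (ZMod.intCast_eq_intCast_iff_dvd_sub i j n).1 hij
    simp only [coe_Icc, Set.mem_Icc] at hi hj
    have := Int.eq_zero_of_abs_lt_dvd hdvd (by rw [abs_lt]; omega)
    omega
  refine ⟨((Icc (-m : ℤ) m).erase 0).image (fun i : ℤ => (i : ZMod n)), ?_, ?_, ?_⟩
  · simp only [mem_image, mem_erase, not_exists, not_and, and_imp]
    intro i hi0 hi h0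
    exact hi0 (hinj hi (by simp) (by simpa using h0))
  · simp only [mem_image, mem_erase, mem_Icc, forall_exists_index, and_imp]
    rintro _ i hi0 hi hi' rfl
    exact ⟨-i, by omega, by simp⟩
  · rw [card_image_of_injOn (hinj.mono (by simp)), card_erase_of_mem (by simp), Int.card_Icc]
    omega

theorem exists_neg_mem_finset {n : ℕ} (hkn : k < n) (hnk : Even (n * k)) :
    ∃ S : Finset (ZMod n), 0 ∉ S ∧ (∀ x ∈ S, -x ∈ S) ∧ #S = k := by
  have : NeZero n := ⟨by omega⟩
  rcases k.even_or_odd with hk | hk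
  · exact exists_neg_mem_finset_of_even hkn hk
  · have hn : Even n := (Nat.even_mul.1 hnk).resolve_right (Nat.not_even_iff_odd.2 hk)
    obtain ⟨S, h0, hneg, hS⟩ := exists_neg_mem_finset_of_even (k := n - 1 - k) (n := n) (by omega)
      (by grind)
    refine ⟨(insert 0 S)ᶜ, by simp, fun x hx => ?_, ?_⟩
    · simp only [mem_compl, mem_insert, neg_eq_zero, not_or] at hx ⊢
      exact ⟨hx.1, fun h => hx.2 (by simpa using hneg _ h)⟩
    · rw [card_compl, card_insert_of_notMem h0, ZMod.card, hS]
      omega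

theorem degree_circulantGraph {A : Type*} [AddGroup A] {S : Finset A}
    (h0 : 0 ∉ S) (hneg : ∀ x ∈ S, -x ∈ S) (x : A)
    [Fintype ((circulantGraph (S : Set A)).neighborSet x)] :
    (circulantGraph (S : Set A)).degree x = #S := by
  have : (circulantGraph (S : Set A)).neighborFinset x = S.image (· + x) := by
    ext y
    simp only [mem_neighborFinset, circulantGraph_adj, mem_coe, mem_image]
    constructor
    · rintro ⟨-, h | h⟩
      · exact ⟨y - x, by simpa using hneg _ h, by simp⟩
      · exact ⟨y - x, h, by simp⟩
    · rintro ⟨s, hs, rfl⟩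
      refine ⟨fun h => h0 ?_, .inr (by simpa using hs)⟩
      rwa [show s = 0 by simpa using h.symm] at hs
  rw [← card_neighborFinset_eq_degree, this, card_image_of_injective _ (add_left_injective x)]

theorem hasFactor_top (hk : k < Fintype.card V) (hVk : Even (Fintype.card V * k)) :
    HasFactor (⊤ : SimpleGraph V) k := by
  have : NeZero (Fintype.card V) := ⟨by omega⟩
  obtain ⟨S, h0, hneg, rfl⟩ := exists_neg_mem_finset hk hVk
  have hS : HasFactor (⊤ : SimpleGraph (ZMod (Fintype.card V))) #S :=
    hasFactor_iff.2 ⟨circulantGraph S, le_top, fun x => by convert degree_circulantGraph h0 hneg x⟩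
  exact hS.of_iso (Iso.completeGraph (Fintype.equivOfCardEq (ZMod.card _)))

end Constructions

section Dense

variable {l t δ : ℕ} {x y : V}

theorem card_edgeFinset_le_choose_add_sum_degree (U : Finset V) [Fintype H.edgeSet] :
    #H.edgeFinset ≤ (#Uᶜ).choose 2 + ∑ x ∈ U, H.degree x := by
  have hsub : H.edgeFinset ⊆
      Uᶜ.offDiag.image Sym2.mk.uncurry ∪ U.biUnion (H.incidenceFinset ·) := by
    intro e
    induction e with | _ a b
    simp only [mem_edgeFinset, mem_edgeSet, mem_union, mem_image, mem_offDiag, mem_compl,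
      mem_biUnion, mem_incidenceFinset, incidenceSet, Set.mem_ofPred_eq, Sym2.mem_iff]
    intro hab
    by_cases h : a ∈ U ∨ b ∈ U
    · exact .inr (by grind)
    · exact .inl ⟨(a, b), by grind [hab.ne], rfl⟩
  calc #H.edgeFinset ≤ #(Uᶜ.offDiag.image Sym2.mk.uncurry) + #(U.biUnion (H.incidenceFinset ·)) :=
        (card_le_card hsub).trans (card_union_le _ _)
    _ ≤ (#Uᶜ).choose 2 + ∑ x ∈ U, #(H.incidenceFinset x) := by
        rw [Sym2.card_image_offDiag]
        gcongr
        exact card_biUnion_le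
    _ = (#Uᶜ).choose 2 + ∑ x ∈ U, H.degree x := by
        simp only [card_incidenceFinset_eq_degree]

theorem degree_add_degree_lt_of_closed (hcl : ∀ u v, ¬ Joinable l H u v) (huv : u ≠ v)
    (hadj : ¬ H.Adj u v) : H.degree u + H.degree v < l :=
  not_le.1 fun h => hcl u v ⟨huv, hadj, h⟩

theorem exists_nonadj_degree_max (hH : H ≠ ⊤) :
    ∃ u v, u ≠ v ∧ ¬ H.Adj u v ∧ H.degree u ≤ H.degree v ∧
      ∀ w, w ≠ v → ¬ H.Adj v w → H.degree w ≤ H.degree u := by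
  obtain ⟨u₀, v₀, h₀⟩ := ne_top_iff_exists_not_adj.1 hH
  obtain ⟨⟨u, v⟩, huv, hmax⟩ := exists_max_image
    ({p | p.1 ≠ p.2 ∧ ¬ H.Adj p.1 p.2} : Finset (V × V)) (fun p => H.degree p.1 + H.degree p.2)
    ⟨(u₀, v₀), by simpa using h₀⟩
  simp only [mem_filter, mem_univ, true_and, Prod.forall] at huv hmax
  rcases le_total (H.degree u) (H.degree v) with h | h
  · exact ⟨u, v, huv.1, huv.2, h, fun w hw hvw =>
      Nat.le_of_add_le_add_right (hmax w v ⟨hw, mt .symm hvw⟩)⟩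
  · exact ⟨v, u, huv.1.symm, mt .symm huv.2, h, fun w hw huw =>
      Nat.le_of_add_le_add_left (hmax u w ⟨hw.symm, huw⟩)⟩

theorem exists_low_degree_set (hcl : ∀ u v, ¬ Joinable l H u v)
    (hl : l + t = Fintype.card V + δ) (hδ : ∀ z, δ ≤ H.degree z) (hH : H ≠ ⊤) :
    ∃ j, 2 * j + δ + t + 1 ≤ Fintype.card V ∧
      ∃ U : Finset V, #U = t + j ∧ ∀ z ∈ U, H.degree z ≤ δ + j := by
  obtain ⟨u, v, huv, hadj, hle, hmax⟩ := exists_nonadj_degree_max hH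
  obtain ⟨j, hj⟩ := Nat.exists_eq_add_of_le (hδ u)
  have hlt := degree_add_degree_lt_of_closed hcl huv hadj
  have hcompl : #(Hᶜ.neighborFinset v) = Fintype.card V - 1 - H.degree v := by
    rw [card_neighborFinset_eq_degree, degree_compl]
  obtain ⟨U, hU, hUcard⟩ := exists_subset_card_eq (s := Hᶜ.neighborFinset v) (n := t + j)
    (by omega)
  refine ⟨j, by omega, U, hUcard, fun z hz => hj ▸ ?_⟩
  have hvz := (mem_neighborFinset _ _ _).1 (hU hz)
  exact hmax z hvz.ne' ((compl_adj _ _ _).1 hvz).2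

theorem choose_two_add_mul_le {n j : ℕ} (hj : 1 ≤ j) (hjn : 2 * j + δ + t + 1 ≤ n)
    (hn : 5 * t + δ + 5 ≤ n) :
    (n - (t + j)).choose 2 + (t + j) * (δ + j) ≤ (n - (t + 1)).choose 2 + (t + 1) * (δ + 1) := by
  have hcast (m : ℕ) : (2 * m.choose 2 : ℤ) = m * (m - 1) := by
    have := Nat.cast_choose_two ℚ m
    qify
    rw [this]
    ring
  have h₁ := hcast (n - (t + j))
  have h₂ := hcast (n - (t + 1))
  zify [show t + j ≤ n by omega, show t + 1 ≤ n by omega] at h₁ h₂ hj hjn hn ⊢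
  nlinarith [mul_nonneg (sub_nonneg.2 hj)
    (show (0 : ℤ) ≤ 2 * (n - t) - 4 - 3 * j - 2 * t - 2 * δ by linarith)]

theorem exists_isClique_compl [Fintype H.edgeSet] (hcl : ∀ u v, ¬ Joinable l H u v)
    (hl : l + t = Fintype.card V + δ) (hδ : ∀ z, δ ≤ H.degree z)
    (hn : 5 * t + δ + 5 ≤ Fintype.card V)
    (he : (Fintype.card V - (t + 1)).choose 2 + (t + 1) * (δ + 1) < #H.edgeFinset) (hH : H ≠ ⊤) :
    ∃ L : Finset V, #L = t ∧ (∀ x ∈ L, H.degree x = δ) ∧ H.IsClique (Lᶜ : Set V) := by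
  obtain ⟨j, hjn, L, hL, hLdeg⟩ := exists_low_degree_set hcl hl hδ hH
  have hsum : ∑ x ∈ L, H.degree x ≤ (t + j) * (δ + j) := by
    rw [← hL, ← smul_eq_mul]
    exact sum_le_card_nsmul _ _ _ hLdeg
  obtain rfl : j = 0 := by
    by_contra hj
    have hcount := card_edgeFinset_le_choose_add_sum_degree (H := H) L
    rw [card_compl, hL] at hcount
    have := choose_two_add_mul_le (Nat.one_le_iff_ne_zero.2 hj) hjn hn
    omega
  refine ⟨L, hL, fun x hx => (hLdeg x hx).antisymm (hδ x), fun x hx y hy hxy => ?_⟩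
  -- A second nonadjacent pair would leave too few edges outside `L ∪ {x, y}`.
  by_contra hadj
  have hx : x ∉ insert y L := by simpa [hxy] using hx
  have hy : y ∉ L := by simpa using hy
  have hlt := degree_add_degree_lt_of_closed hcl hxy hadj
  have hcount := card_edgeFinset_le_choose_add_sum_degree (H := H) (insert x (insert y L))
  rw [sum_insert hx, sum_insert hy, card_compl, card_insert_of_notMem hx,
    card_insert_of_notMem hy, hL] at hcount
  have hchoose : (Fintype.card V - (t + 1)).choose 2 =
      (Fintype.card V - (t + 2)) + (Fintype.card V - (t + 2)).choose 2 := by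
    rw [show Fintype.card V - (t + 1) = Fintype.card V - (t + 2) + 1 by omega, Nat.choose_succ_succ,
      Nat.choose_one_right]
  have hmul : (t + 1) * (δ + 1) = t * δ + t + δ + 1 := by ring
  simp only [add_zero] at hcount hsum
  rw [show t + 1 + 1 = t + 2 from rfl] at hcount
  omega

end Dense

section NearlyComplete

variable {L : Finset V} {l δ : ℕ} {x y d : V}

theorem card_compl_le_degree_add_one (hL : H.IsClique (Lᶜ : Set V)) (hv : v ∉ L) :
    #Lᶜ ≤ H.degree v + 1 := by
  rw [← card_neighborFinset_eq_degree, ← card_erase_add_one (mem_compl.2 hv)]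
  gcongr
  intro w hw
  simp only [mem_erase, mem_compl] at hw
  simpa using hL (by simpa) (by simpa using hw.2) hw.1.symm

theorem card_compl_le_degree (hL : H.IsClique (Lᶜ : Set V)) (hv : v ∉ L) (hx : x ∈ L)
    (hvx : H.Adj v x) : #Lᶜ ≤ H.degree v := by
  rw [← card_neighborFinset_eq_degree, ← card_erase_add_one (mem_compl.2 hv),
    ← card_insert_of_notMem (a := x) (by simp [hx])]
  refine card_le_card fun w hw => ?_
  simp only [mem_insert, mem_erase, mem_compl] at hw
  rcases hw with rfl | hw
  · simpa
  · simpa using hL (by simpa) (by simpa using hw.2) hw.1.symm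

theorem adj_of_adj_of_closed (hcl : ∀ u v, ¬ Joinable l H u v) (hL : H.IsClique (Lᶜ : Set V))
    (hδ : ∀ z ∈ L, δ ≤ H.degree z) (hl : l + #L = Fintype.card V + δ) (hv : v ∉ L) (hx : x ∈ L)
    (hvx : H.Adj v x) (hy : y ∈ L) : H.Adj v y := by
  by_contra hvy
  have hlt := degree_add_degree_lt_of_closed hcl (ne_of_mem_of_not_mem hy hv).symm hvy
  have hdeg := card_compl_le_degree hL hv hx hvx
  have hcard := card_compl_add_card L
  have := hδ y hy
  omega

theorem eq_top_of_closed (hcl : ∀ u v, ¬ Joinable l H u v) (hL : H.IsClique (Lᶜ : Set V))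
    (hδ : ∀ z ∈ L, δ ≤ H.degree z) (hl : l + #L = Fintype.card V + δ)
    (hδL : δ + #L ≤ Fintype.card V) (hu : u ∈ L) (hδu : δ < H.degree u) : H = ⊤ := by
  have hcard := card_compl_add_card L
  have hcross : ∀ v ∉ L, ∀ x ∈ L, H.Adj v x := by
    intro v hv x hx
    refine adj_of_adj_of_closed hcl hL hδ hl hv hu ?_ hx
    by_contra hvu
    have hlt := degree_add_degree_lt_of_closed hcl (ne_of_mem_of_not_mem hu hv).symm hvu
    have := card_compl_le_degree_add_one hL hv
    omega
  have hdeg : ∀ x ∈ L, #Lᶜ ≤ H.degree x := by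
    intro x hx
    rw [← card_neighborFinset_eq_degree]
    exact card_le_card fun v hv => by simpa using (hcross v (by simpa using hv) x hx).symm
  refine top_le_iff.1 fun x y hxy => ?_
  by_cases hx : x ∈ L <;> by_cases hy : y ∈ L
  · by_contra hadj
    have hlt := degree_add_degree_lt_of_closed hcl hxy hadj
    have := hdeg x hx
    have := hdeg y hy
    omega
  · exact (hcross y hy x hx).symm
  · exact hcross x hx y hy
  · exact hL hx hy hxy

theorem IsNearFactor.hasFactor_of_isClique (h : IsNearFactor H F k u v)
    (hL : H.IsClique (Lᶜ : Set V)) (hu : u ∉ L) (hv : v ∉ L)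
    (hcard : 2 * #L + 2 * k < Fintype.card V) : HasFactor H k := by
  by_contra hH
  have hdu := h.degree_add u
  have hdv := h.degree_add v
  simp only [if_true] at hdu hdv
  have hle : #(free H F u) ≤ #(free H F v)ᶜ := by
    refine card_le_card_of_neighborFinset_subset (F := F) (by omega)
      (fun a ha => (h.degree_of_mem_free hH ha).ge) (fun z _ => h.degree_le z) fun a ha b hab => ?_
    exact mem_compl.2 fun hb => h.not_adj_free_free hH ha hb (by simpa using hab)
  have hcu := card_free_add_degree h.le u
  have hcv := card_free_add_degree h.le v
  have := card_compl_le_degree_add_one hL hu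
  have := card_compl_le_degree_add_one hL hv
  rw [card_compl] at *
  omega

/-- `H` is closed for the `k`-factor threshold and consists of a clique and a small set `L` of
vertices of degree `δ`; the value of `#L` is the one at which a vertex outside `L` with a
neighbour in `L` is adjacent to all of `L`. -/
structure IsNearlyComplete (H : SimpleGraph V) (L : Finset V) (k δ : ℕ) : Prop where
  closed : ∀ u v, ¬ Joinable (threshold (Fintype.card V) k) H u v
  isClique : H.IsClique (Lᶜ : Set V)
  degree_eq : ∀ x ∈ L, H.degree x = δ
  threshold_add_card : threshold (Fintype.card V) k + #L = Fintype.card V + δ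
  card_lt : 2 * #L + 2 * k < Fintype.card V

namespace IsNearlyComplete

theorem adj_of_adj (h : IsNearlyComplete H L k δ) (hv : v ∉ L) (hx : x ∈ L) (hvx : H.Adj v x)
    (hy : y ∈ L) : H.Adj v y :=
  adj_of_adj_of_closed h.closed h.isClique (fun z hz => (h.degree_eq z hz).ge)
    h.threshold_add_card hv hx hvx hy

theorem add_card_lt (h : IsNearlyComplete H L k δ) : δ + #L < Fintype.card V := by
  have hadd := h.threshold_add_card
  have hlt := h.card_lt
  rw [threshold] at hadd
  split_ifs at hadd <;> omega

theorem closure_sup_edge (h : IsNearlyComplete H L k δ) (hu : u ∈ L) (huv : u ≠ v)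
    (hadj : ¬ H.Adj u v) : closure (threshold (Fintype.card V) k) (H ⊔ edge u v) = ⊤ := by
  have hcl := closure_isClosure (threshold (Fintype.card V) k) (H ⊔ edge u v)
  have hle : H ≤ closure (threshold (Fintype.card V) k) (H ⊔ edge u v) := le_sup_left.trans hcl.le
  refine eq_top_of_closed hcl.2 (h.isClique.mono hle)
    (fun z hz => (h.degree_eq z hz).symm.le.trans (degree_le_of_le hle)) h.threshold_add_card
    h.add_card_lt.le hu ?_
  calc δ < H.degree u + 1 := by rw [h.degree_eq u hu]; exact Nat.lt_succ_self δ
    _ = (H ⊔ edge u v).degree u := by simp [degree_sup_edge huv hadj, huv]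
    _ ≤ _ := degree_le_of_le hcl.le

theorem exists_isNearFactor (h : IsNearlyComplete H L k δ) (hk : 1 ≤ k)
    (hVk : Even (Fintype.card V * k)) (hH : ¬ HasFactor H k) (hu : u ∈ L) :
    ∃ v ∉ L, ¬ H.Adj u v ∧ ∃ F, IsNearFactor H F k u v := by
  obtain ⟨v, hv⟩ : (L ∪ H.neighborFinset u)ᶜ.Nonempty := by
    rw [← card_pos, card_compl]
    have := card_union_le L (H.neighborFinset u)
    have := h.add_card_lt
    rw [card_neighborFinset_eq_degree, h.degree_eq u hu] at *
    omega
  simp only [mem_compl, mem_union, mem_neighborFinset, not_or] at hv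
  refine ⟨v, hv.1, hv.2, HasFactor.of_sup_edge (hasFactor_of_closure hk ?_) |>.resolve_left hH⟩
  rw [h.closure_sup_edge hu (ne_of_mem_of_not_mem hu hv.1) hv.2]
  exact hasFactor_top (by have := h.card_lt; omega) hVk

theorem card_free_add_eq (h : IsNearlyComplete H L k δ) (hF : IsNearFactor H F k u v) (hu : u ∈ L)
    (hv : v ∉ L) : #(free H F u) + k = δ + 1 := by
  have hdeg := hF.degree_left (ne_of_mem_of_not_mem hu hv)
  have hcard := card_free_add_degree hF.le u
  rw [h.degree_eq u hu] at hcard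
  omega

section NearFactor

variable (h : IsNearlyComplete H L k δ) (hH : ¬ HasFactor H k) (hF : IsNearFactor H F k u v)
  (hu : u ∈ L) (hv : v ∉ L)

include h hH hF hv

theorem neighborFinset_subset_of_mem_free {a : V} (ha : a ∈ free H F u) :
    F.neighborFinset a ⊆ L := by
  intro x hx
  by_contra hxL
  exact hH ((hF.rotate ha (by simpa using hx)).hasFactor_of_isClique h.isClique hxL hv h.card_lt)

theorem neighborFinset_subset_erase {a : V} (ha : a ∈ free H F u) :
    F.neighborFinset a ⊆ L.erase u :=
  subset_erase.2 ⟨h.neighborFinset_subset_of_mem_free hH hF hv ha, by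
    simpa [SimpleGraph.adj_comm] using (mem_free.1 ha).2⟩

include hu

theorem le_two : k ≤ 2 := by
  have hk := hF.degree_left (ne_of_mem_of_not_mem hu hv)
  have hle := card_le_card_of_neighborFinset_subset (F := F) (k := k) (by omega)
    (fun a ha => (hF.degree_of_mem_free hH ha).ge) (fun z _ => hF.degree_le z)
    fun a ha => h.neighborFinset_subset_erase hH hF hv ha
  have hcard := h.card_free_add_eq hF hu hv
  have hadd := h.threshold_add_card
  have hpos := card_pos.2 ⟨u, hu⟩
  rw [card_erase_of_mem hu] at hle
  rw [threshold] at hadd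
  split_ifs at hadd <;> omega

theorem neighborFinset_subset_free (hy : y ∈ L.erase u) :
    F.degree y = k ∧ F.neighborFinset y ⊆ free H F u := by
  have hle := h.le_two hH hF hu hv
  have hk := hF.degree_left (ne_of_mem_of_not_mem hu hv)
  refine saturated_of_neighborFinset_subset (fun a ha => (hF.degree_of_mem_free hH ha).ge)
    (fun z _ => hF.degree_le z) (fun a ha => h.neighborFinset_subset_erase hH hF hv ha) ?_ hy
  have hcard := h.card_free_add_eq hF hu hv
  have hadd := h.threshold_add_card
  rw [card_erase_of_mem hu]
  rw [threshold] at hadd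
  split_ifs at hadd <;> omega

theorem neighborFinset_subset_of_mem_free_of_mem {w : V} (hw : w ∈ L) (hy : y ∈ free H F w) :
    F.neighborFinset y ⊆ L := by
  rcases eq_or_ne w u with rfl | hwu
  · exact h.neighborFinset_subset_of_mem_free hH hF hv hy
  obtain ⟨hdeg, hsub⟩ := h.neighborFinset_subset_free hH hF hu hv (mem_erase.2 ⟨hwu, hw⟩)
  obtain ⟨a, hwa⟩ : ∃ a, F.Adj w a := by
    have := hF.degree_left (ne_of_mem_of_not_mem hu hv)
    rw [← degree_pos_iff_exists_adj]
    omega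
  have ha : a ∈ free H F u := hsub (by simpa using hwa)
  intro z hz
  have hyz : F.Adj y z := by simpa using hz
  -- Moving the deficit first from `u` to `w` and then on to `z` preserves the edges at `y`.
  have hrot := hF.rotate ha hwa.symm
  have hy' := mem_free.1 hy
  have hy'' : y ∈ free H (rotate F u a w) w := mem_free.2 ⟨hy'.1, by grind [rotate_adj, hwa.ne]⟩
  refine h.neighborFinset_subset_of_mem_free hH hrot hv hy'' ?_
  rw [mem_neighborFinset]
  grind [rotate_adj, SimpleGraph.adj_comm, hy'.1.ne]

end NearFactor

theorem hasFactor (h : IsNearlyComplete H L k δ) (hk : 2 ≤ k) (hkδ : 2 ≤ #L)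
    (hVk : Even (Fintype.card V * k)) : HasFactor H k := by
  by_contra hH
  obtain ⟨u, hu, x, hx, hux⟩ := one_lt_card.1 hkδ
  obtain ⟨v, hv, huv, F, hF⟩ := h.exists_isNearFactor (by omega) hVk hH hu
  obtain rfl : k = 2 := (h.le_two hH hF hu hv).antisymm hk
  have hdeg := hF.degree_left (ne_of_mem_of_not_mem hu hv)
  obtain ⟨c, huc⟩ : ∃ c, F.Adj u c := by
    rw [← degree_pos_iff_exists_adj]
    omega
  have hcfree : c ∉ free H F u := fun hc => (mem_free.1 hc).2 huc
  have hsat : ∀ y ∈ L, y ≠ u → ¬ F.Adj y c := fun y hy hyu hyc => hcfree <|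
    (h.neighborFinset_subset_free hH hF hu hv (mem_erase.2 ⟨hyu, hy⟩)).2 (by simpa using hyc)
  have hcL : c ∉ L := fun hc => (mem_free.1 <|
    (h.neighborFinset_subset_free hH hF hu hv (mem_erase.2 ⟨huc.ne', hc⟩)).2
      (by simpa using huc.symm)).1.ne rfl
  have hcx : c ∈ free H F x :=
    mem_free.2 ⟨(h.adj_of_adj hcL hu (hF.le huc).symm hx).symm, hsat x hx hux.symm⟩
  have hNc : F.neighborFinset c ⊆ {u} := fun z hz => by
    have hzL := h.neighborFinset_subset_of_mem_free_of_mem hH hF hu hv hx hcx hz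
    by_contra hzu
    exact hsat z hzL (by simpa using hzu) (by simpa using (mem_neighborFinset _ _ _ |>.1 hz).symm)
  have hle := card_le_card hNc
  rw [card_neighborFinset_eq_degree, hF.degree_eq huc.ne' fun hcv => huv (hcv ▸ hF.le huc)] at hle
  simp at hle

theorem exists_not_adj_of_adj (h : IsNearlyComplete H L 1 δ) (hV : Even (Fintype.card V))
    (hH : ¬ HasFactor H 1) (hu : u ∈ L) (hd : d ∉ L) (hdu : H.Adj d u) :
    ∃ y ∈ L, ∀ w ∈ L, ¬ H.Adj y w := by
  obtain ⟨v, hv, -, F, hF⟩ := h.exists_isNearFactor le_rfl (by simpa) hH hu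
  have hdeg := hF.degree_left (ne_of_mem_of_not_mem hu hv)
  have hud : ¬ F.Adj u d := fun hud => by
    have := (F.degree_pos_iff_exists_adj u).2 ⟨d, hud⟩
    omega
  have hdfree : d ∈ free H F u := mem_free.2 ⟨hdu.symm, hud⟩
  obtain ⟨y, hdy⟩ : ∃ y, F.Adj d y := by
    rw [← degree_pos_iff_exists_adj, hF.degree_of_mem_free hH hdfree]
    exact one_pos
  have hyL : y ∈ L := h.neighborFinset_subset_of_mem_free hH hF hv hdfree (by simpa using hdy)
  refine ⟨y, hyL, fun w hw hyw => ?_⟩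
  have hyw' : ¬ F.Adj y w := fun hyw' => by
    have hone := card_le_one.1 ((card_neighborFinset_eq_degree F y).trans_le (hF.degree_le y))
    exact hd (hone w (by simpa using hyw') d (by simpa using hdy.symm) ▸ hw)
  exact hd (h.neighborFinset_subset_of_mem_free_of_mem hH hF hu hv hw
    (mem_free.2 ⟨hyw.symm, mt .symm hyw'⟩) (by simpa using hdy.symm))

theorem exists_neighborFinset_eq (h : IsNearlyComplete H L 1 δ) (hV : Even (Fintype.card V))
    (hH : ¬ HasFactor H 1) (hu : u ∈ L) (hd : d ∉ L) (hdu : H.Adj d u) :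
    ∃ D : Finset V, #D = δ ∧ Disjoint D L ∧ ∀ x ∈ L, H.neighborFinset x = D := by
  obtain ⟨y, hy, hyL⟩ := h.exists_not_adj_of_adj hV hH hu hd hdu
  have hdeg : ∀ x ∈ L, #(H.neighborFinset x) = δ := fun x hx =>
    (card_neighborFinset_eq_degree H x).trans (h.degree_eq x hx)
  have hdisj : Disjoint (H.neighborFinset y) L :=
    disjoint_left.2 fun w hw hwL => hyL w hwL (by simpa using hw)
  refine ⟨H.neighborFinset y, hdeg y hy, hdisj, fun x hx => ?_⟩
  refine (eq_of_subset_of_card_le (fun w hw => ?_) (by rw [hdeg x hx, hdeg y hy])).symm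
  have hwy : H.Adj w y := by simpa [SimpleGraph.adj_comm] using hw
  simpa using (h.adj_of_adj (disjoint_left.1 hdisj hw) hy hwy hx).symm

end IsNearlyComplete

end NearlyComplete

section Isomorphism

variable {W γ : Type*} [Fintype W] {G' : SimpleGraph W} {L D : Finset V} {a b c : ℕ}

theorem nonempty_iso_of_card_fiber {r : γ → γ → Prop} {f : V → γ} {g : W → γ}
    (hG : ∀ x y, G.Adj x y ↔ x ≠ y ∧ r (f x) (f y))
    (hG' : ∀ x y, G'.Adj x y ↔ x ≠ y ∧ r (g x) (g y))
    (hcard : ∀ i, #{x | f x = i} = #{y | g y = i}) : Nonempty (G ≃g G') := by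
  let e := Equiv.ofFiberEquiv fun i => Fintype.equivOfCardEq <|
    (Fintype.card_subtype _).trans <| (hcard i).trans (Fintype.card_subtype _).symm
  have he : ∀ x, g (e x) = f x := Equiv.ofFiberEquiv_map _
  exact ⟨e, by simp [hG, hG', he]⟩

theorem card_filter_sum {α β : Type*} [Fintype α] [Fintype β] (p : α ⊕ β → Prop) :
    #{x | p x} = #{x | p (.inl x)} + #{y | p (.inr y)} := by
  simp only [card_filter, Fintype.sum_sum_type]

theorem nonempty_iso_sum_completeGraph (hL : #L = b) (hLc : #Lᶜ = a)
    (hclique : H.IsClique (Lᶜ : Set V)) (hN : ∀ x ∈ L, H.neighborFinset x = L.erase x) :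
    Nonempty (H ≃g completeGraph (Fin a) ⊕g completeGraph (Fin b)) := by
  refine nonempty_iso_of_card_fiber (r := Eq) (f := (· ∈ L)) (g := fun p => p.isRight = true)
    (fun x y => ?_) (fun p q => ?_) fun i => ?_
  · have hN' : ∀ x ∈ L, ∀ y, H.Adj x y ↔ y ∈ L.erase x := fun x hx y => by
      rw [← hN x hx, mem_neighborFinset]
    have hxy := @hclique x
    grind [SimpleGraph.adj_comm, SimpleGraph.Adj.ne]
  · rcases p with p | p <;> rcases q with q | q <;> simp
  · rw [card_filter_sum]
    by_cases hi : i
    · simp [hi, hL]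
    · simp [hi, ← hLc, filter_not, compl_eq_univ_sdiff]

theorem nonempty_iso_join_completeGraph (hL : #L = c) (hD : #D = a) (hDL : Disjoint D L)
    (habc : a + b + c = Fintype.card V) (hclique : H.IsClique (Lᶜ : Set V))
    (hN : ∀ x ∈ L, H.neighborFinset x = D) :
    Nonempty (H ≃g join (completeGraph (Fin a)) (completeGraph (Fin b) ⊕g emptyGraph (Fin c))) := by
  refine nonempty_iso_of_card_fiber (γ := Fin 3)
    (r := fun i j => (i = 2 → j = 0) ∧ (j = 2 → i = 0))
    (f := fun x => if x ∈ D then 0 else if x ∈ L then 2 else 1)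
    (g := Sum.elim 0 (Sum.elim 1 2)) (fun x y => ?_) (fun p q => ?_) fun i => ?_
  · have hN' : ∀ x ∈ L, ∀ y, H.Adj x y ↔ y ∈ D := fun x hx y => by
      rw [← hN x hx, mem_neighborFinset]
    have hxy := @hclique x
    have hdisj := disjoint_left.1 hDL
    grind [SimpleGraph.adj_comm, SimpleGraph.Adj.ne]
  · rcases p with p | p | p <;> rcases q with q | q | q <;> simp [join]
  · have hdisj := disjoint_left.1 hDL
    have hcompl := card_compl_add_card (D ∪ L)
    rw [card_union_of_disjoint hDL, hD, hL] at hcompl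
    trans ![#D, #(D ∪ L)ᶜ, #L] i
    · fin_cases i <;> dsimp <;> congr 1 <;> ext x <;> grind [mem_compl]
    · rw [card_filter_sum, card_filter_sum]
      fin_cases i <;> simp [-compl_union] <;> omega

theorem not_hasFactor_of_iso_sum (hb : Odd b) (hk : Odd k)
    (e : H ≃g completeGraph (Fin a) ⊕g completeGraph (Fin b)) : ¬ HasFactor H k := by
  intro h
  have heven := (hasFactor_sum_iff.1 (h.of_iso e)).2.even_card_mul
  rw [Fintype.card_fin] at heven
  exact Nat.not_even_iff_odd.2 (hb.mul hk) heven

theorem not_hasFactor_of_iso_join (hk : 0 < k) (hac : a < c)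
    (e : H ≃g join (completeGraph (Fin a)) (completeGraph (Fin b) ⊕g emptyGraph (Fin c))) :
    ¬ HasFactor H k := fun h => by
  have hle := card_le_of_hasFactor_join hk (h.of_iso e)
  rw [Fintype.card_fin, Fintype.card_fin] at hle
  exact hac.not_ge hle

end Isomorphism

section Main

variable {L : Finset V} {δ t : ℕ}

namespace IsNearlyComplete

theorem card_eq_of_one (h : IsNearlyComplete H L 1 δ) : #L = δ + 1 := by
  have hadd := h.threshold_add_card
  have hlt := h.card_lt
  rw [threshold, if_pos rfl] at hadd
  omega

theorem nonempty_iso_sum (h : IsNearlyComplete H L 1 δ) (hcross : ∀ d ∉ L, ∀ u ∈ L, ¬ H.Adj d u) :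
    Nonempty (H ≃g completeGraph (Fin (Fintype.card V - δ - 1)) ⊕g
      completeGraph (Fin (δ + 1))) := by
  have hL := h.card_eq_of_one
  refine nonempty_iso_sum_completeGraph hL (by rw [card_compl, hL, Nat.sub_sub]) h.isClique
    fun x hx => eq_of_subset_of_card_le (fun w hw => ?_) ?_
  · have hxw : H.Adj x w := by simpa using hw
    exact mem_erase.2 ⟨hxw.ne', by_contra fun hwL => hcross w hwL x hx hxw.symm⟩
  · rw [card_erase_of_mem hx, hL, card_neighborFinset_eq_degree, h.degree_eq x hx]
    exact le_rfl

theorem even_of_iso_sum (h : IsNearlyComplete H L 1 δ) (hV : Even (Fintype.card V))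
    (hH : ¬ HasFactor H 1) (e : H ≃g completeGraph (Fin (Fintype.card V - δ - 1)) ⊕g
      completeGraph (Fin (δ + 1))) : Even δ := by
  have hlt := h.card_lt
  rw [h.card_eq_of_one] at hlt
  by_contra hδ
  have hδ' : Even (δ + 1) := (Nat.not_even_iff_odd.1 hδ).add_one
  refine hH (HasFactor.of_iso e.symm (hasFactor_sum_iff.2
    ⟨hasFactor_top ?_ ?_, hasFactor_top ?_ ?_⟩)) <;> rw [Fintype.card_fin]
  · omega
  · rw [mul_one, Nat.sub_sub]
    exact (Nat.even_sub (by omega)).2 (iff_of_true hV hδ')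
  · grind
  · simpa using hδ'

theorem nonempty_iso_of_not_hasFactor (h : IsNearlyComplete H L 1 δ) (hV : Even (Fintype.card V))
    (hH : ¬ HasFactor H 1) :
    (Even δ ∧ Nonempty (H ≃g completeGraph (Fin (Fintype.card V - δ - 1)) ⊕g
      completeGraph (Fin (δ + 1)))) ∨
    Nonempty (H ≃g join (completeGraph (Fin δ))
      (completeGraph (Fin (Fintype.card V - 2 * δ - 1)) ⊕g emptyGraph (Fin (δ + 1)))) := by
  have hL := h.card_eq_of_one
  by_cases hcross : ∀ d ∉ L, ∀ u ∈ L, ¬ H.Adj d u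
  · obtain ⟨e⟩ := h.nonempty_iso_sum hcross
    exact .inl ⟨h.even_of_iso_sum hV hH e, ⟨e⟩⟩
  · push Not at hcross
    obtain ⟨d, hd, u, hu, hdu⟩ := hcross
    obtain ⟨D, hD, hDL, hN⟩ := h.exists_neighborFinset_eq hV hH hu hd hdu
    have hlt := h.card_lt
    exact .inr (nonempty_iso_join_completeGraph hL hD hDL (by omega) h.isClique hN)

end IsNearlyComplete

variable [DecidableRel G.Adj]

theorem hasFactor_or_exists_isNearlyComplete (hk : 1 ≤ k) (hVk : Even (Fintype.card V * k))
    (hδ : δ ≤ G.minDegree) (hl : threshold (Fintype.card V) k + t = Fintype.card V + δ)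
    (hn : 5 * t + δ + 5 ≤ Fintype.card V) (ht : 2 * t + 2 * k < Fintype.card V)
    (he : (Fintype.card V - (t + 1)).choose 2 + (t + 1) * (δ + 1) < #G.edgeFinset) :
    HasFactor G k ∨
      ∃ L, #L = t ∧ IsNearlyComplete (closure (threshold (Fintype.card V) k) G) L k δ := by
  have hcl := closure_isClosure (threshold (Fintype.card V) k) G
  by_cases htop : closure (threshold (Fintype.card V) k) G = ⊤
  · refine .inl (hasFactor_of_closure hk ?_)
    rw [htop]
    exact hasFactor_top (by omega) hVk
  · obtain ⟨L, rfl, hdeg, hclique⟩ := exists_isClique_compl hcl.2 hl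
      (fun z => (hδ.trans (G.minDegree_le_degree z)).trans (degree_le_of_le hcl.le)) hn
      (he.trans_le (card_le_card (edgeFinset_mono hcl.le))) htop
    exact .inr ⟨L, rfl, hcl.2, hclique, hdeg, hl, ht⟩

theorem phiOne_two {n : ℕ} (hn : δ + 2 ≤ n) :
    phiOne n 2 (δ + 1) = ((n - (δ + 1 + 1)).choose 2 + (δ + 1 + 1) * (δ + 1) : ℕ) := by
  rw [phiOne, show (n - (δ + 1) - 1 : ℤ) = (n - (δ + 1 + 1) : ℕ) by omega, Ring.choose_natCast,
    Ring.choose_one_right]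
  push_cast
  ring

theorem phiTwo_two {n : ℕ} (hkδ : 2 * k ≤ δ + 4) (hn : δ + 5 ≤ n + 2 * k) :
    phiTwo n 2 k (δ + 1) =
      ((n - (δ + 4 - 2 * k + 1)).choose 2 + (δ + 4 - 2 * k + 1) * (δ + 1) : ℕ) := by
  rw [phiTwo, show (n - (δ + 1) + 2 * k - 4 : ℤ) = (n - (δ + 4 - 2 * k + 1) : ℕ) by omega,
    Ring.choose_natCast, Ring.choose_one_right]
  push_cast [hkδ]
  ring

theorem nonempty_iso_of_not_hasFactor_one (hV : Even (Fintype.card V))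
    (hn : 6 * δ + 10 ≤ Fintype.card V) (hδ : δ ≤ G.minDegree)
    (he : phiOne (Fintype.card V) 2 (δ + 1) < #G.edgeFinset) (hG : ¬ HasFactor G 1) :
    (Even δ ∧ Nonempty (closure (Fintype.card V - 1) G ≃g
      completeGraph (Fin (Fintype.card V - δ - 1)) ⊕g completeGraph (Fin (δ + 1)))) ∨
    Nonempty (closure (Fintype.card V - 1) G ≃g join (completeGraph (Fin δ))
      (completeGraph (Fin (Fintype.card V - 2 * δ - 1)) ⊕g emptyGraph (Fin (δ + 1)))) := by
  have hl : threshold (Fintype.card V) 1 = Fintype.card V - 1 := if_pos rfl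
  rw [phiOne_two (by omega), Nat.cast_lt] at he
  obtain ⟨L, -, hL⟩ := (hasFactor_or_exists_isNearlyComplete le_rfl (by simpa) hδ (by omega)
    (by omega) (by omega) he).resolve_left hG
  rw [← hl]
  exact hL.nonempty_iso_of_not_hasFactor hV (mt (hasFactor_of_closure le_rfl) hG)

theorem hasFactor_of_phiTwo_lt (hk : 2 ≤ k) (hVk : Even (Fintype.card V * k))
    (hn : 6 * δ + 4 * k - 3 ≤ Fintype.card V) (hkδ : 2 * k - 2 ≤ δ) (hδ : δ ≤ G.minDegree)
    (he : phiTwo (Fintype.card V) 2 k (δ + 1) < #G.edgeFinset) : HasFactor G k := by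
  have hl : threshold (Fintype.card V) k = Fintype.card V + 2 * k - 4 := if_neg (by omega)
  rw [phiTwo_two (by omega) (by omega), Nat.cast_lt] at he
  rcases hasFactor_or_exists_isNearlyComplete (by omega) hVk hδ (by omega) (by omega) (by omega) he
    with hG | ⟨L, hL, hH⟩
  · exact hG
  · exact hasFactor_of_closure (by omega) (hH.hasFactor hk (by omega) hVk)

end Main

end

end KFactor

theorem corollary1p5 {V : Type*} [Fintype V] (G : SimpleGraph V) [DecidableRel G.Adj]
    (n δ : ℕ) (hn : Fintype.card V = n) (hδ : δ ≤ G.minDegree) :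
    (Even n → 6 * δ + 10 ≤ n → 1 ≤ δ → δ ≤ n / 2 - 1 →
      (G.edgeFinset.card : ℤ) > KFactor.phiOne n 2 (δ + 1) →
      (KFactor.HasFactor G 1 ↔
        ¬ ((Even δ ∧ Nonempty (KFactor.closure (n - 1) G ≃g
              (SimpleGraph.completeGraph (Fin (n - δ - 1)) ⊕g SimpleGraph.completeGraph (Fin (δ + 1))))) ∨
           Nonempty (KFactor.closure (n - 1) G ≃g
              KFactor.join (SimpleGraph.completeGraph (Fin δ))
                (SimpleGraph.completeGraph (Fin (n - 2 * δ - 1)) ⊕g SimpleGraph.emptyGraph (Fin (δ + 1))))))) ∧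
    (∀ k : ℕ, 2 ≤ k → Even (n * k) → 6 * δ + 4 * k - 3 ≤ n →
      2 * k - 2 ≤ δ → δ ≤ (n + 2 * k - 5) / 2 →
      (G.edgeFinset.card : ℤ) > KFactor.phiTwo n 2 k (δ + 1) →
      KFactor.HasFactor G k) := by
  subst hn
  refine ⟨fun hV hn _ _ he => ⟨fun hG => ?_, fun hex => ?_⟩, fun k hk hVk hn hkδ _ he =>
    KFactor.hasFactor_of_phiTwo_lt hk hVk hn hkδ hδ he⟩
  · have hH := hG.mono (KFactor.closure_isClosure (Fintype.card V - 1) G).le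
    rintro (⟨hδ_even, ⟨e⟩⟩ | ⟨⟨e⟩⟩)
    · exact KFactor.not_hasFactor_of_iso_sum hδ_even.add_one odd_one e hH
    · exact KFactor.not_hasFactor_of_iso_join one_pos δ.lt_succ_self e hH
  · by_contra hG
    exact hex (KFactor.nonempty_iso_of_not_hasFactor_one hV hn hδ he hG)
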